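/- For $\varepsilon>0$ let $\eta_\varepsilon$ be the ground state, that is, a positive solution of $\varepsilon^2\eta_\varepsilon''(x)+(1-x^2-\eta_\varepsilon^2(x))\eta_\varepsilon(x)=0$ on $\mathbb{R}$ with $\eta_\varepsilon(x)\to 0$ as $|x|\to\infty$. Let $a=a(t)\in(0,1)$ and $b=b(t)\in(-1,1)$ be differentiable, set $$A=\sqrt{1-b^2},\qquad B=\frac{\sqrt{1-a^2}\sqrt{1-b^2}}{\sqrt2},\qquad z_\pm=\varepsilon^{-1}B(x\pm a),$$ and write dots for time derivatives. For the 2-soliton ansatz $v_2=(A\tanh z_+-ib)(A\tanh z_-+ib)$ and $K(v)=\frac{i}{2}\varepsilon\int_{\mathbb R}\eta_\varepsilon^2(v\bar v_t-\bar v v_t)\,dx$, the overlap part of $K(v_2)/(2\varepsilon)$ (the terms containing both $z_+$ and $z_-$) is $$K_{\rm overlap}=\tfrac12\dot b(1-b^2)^{1/2}\int_{\mathbb R}\eta_\varepsilon^2\left(\tanh z_+\,{\rm sech}^2z_--\tanh z_-\,{\rm sech}^2z_+\right)dx-\varepsilon^{-1}b(1-b^2)^{3/2}(B\dot a+\dot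 Ba)\int_{\mathbb R}\eta_\varepsilon^2\,{\rm sech}^2z_+\,{\rm sech}^2z_-\,dx.$$ Let $C_1,C_2>0$. Then, as $\varepsilon\to0^+$, uniformly over all $a,b$ as above and all times at which $$a\le C_1\varepsilon^{1/6},\qquad e^{-4Ba/\varepsilon}\le C_2\,\varepsilon^2|\log\varepsilon|,$$ one has $$K_{\rm overlap}=2\varepsilon\dot b(1-b^2)^{1/2}B^{-1}(1-a^2)\left(1+O(\varepsilon^{1/3})\right)-16b(1-b^2)^{3/2}(\dot a+B^{-1}\dot Ba)(1-a^2)e^{-4Ba/\varepsilon}\left(\frac{2Ba}{\varepsilon}-1\right)\left(1+O(\varepsilon^{1/3})\right).$$ Here each $O(\varepsilon^{1/3})$ is, for given $\varepsilon$, a function of the values of $(a,b)$ only, bounded in absolute value by $C\varepsilon^{1/3}$ for all $0<\varepsilon<\varepsilon_0$, where $C,\varepsilon_0>0$ depend only on $C_1,C_2$. -/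

import Mathlib

open Filter Topology

namespace DarkSoliton

noncomputable section

/-- Hyperbolic secant. -/
def sech (x : ℝ) : ℝ := 1 / Real.cosh x

/-- `η` is a ground state of the stationary Gross-Pitaevskii equation with harmonic potential: a
positive classical solution of `ε² η'' + (1 - x² - η²) η = 0` on the whole line which decays to
zero as `|x| → ∞`. -/
structure IsGroundState (ε : ℝ) (η : ℝ → ℝ) : Prop where
  contDiff : ContDiff ℝ 2 η
  pos : ∀ x, 0 < η x
  eqn : ∀ x, ε ^ 2 * deriv (deriv η) x + (1 - x ^ 2 - η x ^ 2) * η x = 0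
  decay : Tendsto η (cocompact ℝ) (𝓝 0)

/-- The inverse width `B(t) = √(1 - a(t)²) √(1 - b(t)²) / √2` of the dark solitons. -/
def width (a b : ℝ → ℝ) (t : ℝ) : ℝ :=
  √(1 - a t ^ 2) * √(1 - b t ^ 2) / √2

/-- The variable `z₊ = ε⁻¹ B (x + a)` of the soliton centred at `-a`, at time `t`. -/
def zPlus (ε : ℝ) (a b : ℝ → ℝ) (t x : ℝ) : ℝ := ε⁻¹ * width a b t * (x + a t)

/-- The variable `z₋ = ε⁻¹ B (x - a)` of the soliton centred at `a`, at time `t`. -/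
def zMinus (ε : ℝ) (a b : ℝ → ℝ) (t x : ℝ) : ℝ := ε⁻¹ * width a b t * (x - a t)

/-- The overlap part, at time `t`, of `K(v₂) / (2ε)`, where
`K(v) = (i/2) ε ∫ η² (v v̄ₜ - v̄ vₜ) dx` and `v₂ = (A tanh z₊ - i b) (A tanh z₋ + i b)` with
`A = √(1 - b²)`: the terms that contain both `z₊` and `z₋`. Dots are time derivatives. -/
def kineticOverlap (ε : ℝ) (η a b : ℝ → ℝ) (t : ℝ) : ℝ :=
  1 / 2 * deriv b t * (1 - b t ^ 2) ^ (1 / 2 : ℝ) *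
      (∫ x, η x ^ 2 *
        (Real.tanh (zPlus ε a b t x) * sech (zMinus ε a b t x) ^ 2
          - Real.tanh (zMinus ε a b t x) * sech (zPlus ε a b t x) ^ 2))
    - ε⁻¹ * b t * (1 - b t ^ 2) ^ (3 / 2 : ℝ) *
        (width a b t * deriv a t + deriv (width a b) t * a t) *
      (∫ x, η x ^ 2 * (sech (zPlus ε a b t x) ^ 2 * sech (zMinus ε a b t x) ^ 2))

end

end DarkSoliton

namespace DarkSoliton

/-! With `κ = B / ε`, `τ = κ a` and `z = κ x`, both integrals in the overlap become integrals of
explicit profiles `tanhOverlap τ` and `sechOverlap τ` against `η²`. For `η² = 1` they have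
elementary primitives: the first integral is `4 + O(e^{-2τ})`, the second `16 e^{-4τ} (2τ - 1) (1 +
O(e^{-2τ}))`.

Replacing `η²` by `1` is controlled by `1 - 2x² - 5ε ≤ η² ≤ 1`, which follows from the maximum
principle (`IsGroundState.le_one`) and comparison with a cosine bump
(`IsGroundState.one_sub_sq_le`). The cost is the second moment of the profile divided by `κ²`, of
relative size `(τ / κ)² = a²`, plus a relative `O(ε)`.

The hypotheses give `a² = O(ε^{1/3})` and, through `one_le_and_exp_le_of_overlap_le`, `τ ≥ 1` and
`e^{-2τ} = O(ε^{1/3})`. The factor `1 - a²` of the claim is itself `1 + O(ε^{1/3})`, so inserting it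
is harmless. -/

theorem deriv_deriv_nonpos_of_isLocalMax {g : ℝ → ℝ} {x₀ : ℝ} (hg : ContinuousAt g x₀)
    (h : IsLocalMax g x₀) : deriv (deriv g) x₀ ≤ 0 := by
  by_contra! hpos
  -- A positive second derivative would make the maximum a local minimum too, hence `g` locally
  -- constant.
  have hmin := isLocalMin_of_deriv_deriv_pos hpos h.deriv_eq_zero hg
  have hconst : g =ᶠ[𝓝 x₀] fun _ => g x₀ := by
    filter_upwards [h, hmin] with x h1 h2 using le_antisymm h1 h2
  have h0 : deriv (deriv g) x₀ = 0 := by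
    rw [hconst.deriv.deriv_eq]
    simp
  exact hpos.ne' h0

/-! ### Pointwise bounds on the ground state -/

namespace IsGroundState

variable {ε : ℝ} {η : ℝ → ℝ}

/-- Positivity and decay give a global maximum; there `η'' ≤ 0`, so the equation forces `η² ≤ 1 -
x₀²`. -/
theorem le_one (h : IsGroundState ε η) (x : ℝ) : η x ≤ 1 := by
  have hc : Continuous η := h.contDiff.continuous
  obtain ⟨x₀, hx₀⟩ : ∃ x₀, ∀ y, η y ≤ η x₀ :=
    hc.exists_forall_ge' 0 ((h.decay.eventually (gt_mem_nhds (h.pos 0))).mono fun _ hy => hy.le)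
  have h2 : deriv (deriv η) x₀ ≤ 0 :=
    deriv_deriv_nonpos_of_isLocalMax hc.continuousAt (Eventually.of_forall hx₀)
  have heq := h.eqn x₀
  have hp := h.pos x₀
  have h3 : 0 ≤ (1 - x₀ ^ 2 - η x₀ ^ 2) * η x₀ := by nlinarith [sq_nonneg ε]
  have h4 : 0 ≤ 1 - x₀ ^ 2 - η x₀ ^ 2 := nonneg_of_mul_nonneg_left h3 hp
  have h5 : η x₀ ≤ 1 := by nlinarith [sq_nonneg x₀]
  exact (hx₀ x).trans h5

/-- A ground state lies above the subsolution `m cos (k (x - y))` on the window where the latter is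
nonnegative. -/
theorem le_of_subsolution (h : IsGroundState ε η) {m k y r : ℝ} (hm : 0 < m) (hr : 0 < r)
    (hkr : k * r = Real.pi / 2)
    (hsub : ∀ x ∈ Set.Icc (y - r) (y + r), m ^ 2 ≤ 1 - x ^ 2 - ε ^ 2 * k ^ 2) : m ≤ η y := by
  have hc : Continuous η := h.contDiff.continuous
  set φ : ℝ → ℝ := fun x => m * Real.cos (k * (x - y)) with hφ
  have hφc : Continuous φ := by fun_prop
  obtain ⟨x₀, hx₀, hmax⟩ := (isCompact_Icc (a := y - r) (b := y + r)).exists_isMaxOn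
    ⟨y, by constructor <;> linarith⟩ ((hφc.div hc fun x => (h.pos x).ne').continuousOn)
  -- `M` is the least multiple for which `M η` lies above the bump. If `η y < m` then `M > 1` and
  -- contact is interior. The second-order condition at contact gives `η² ≥ 1 - x₀² - ε²k² ≥ m² ≥
  -- φ²`, whereas `M > 1` gives `η < φ`.
  set M := φ x₀ / η x₀ with hM
  have hp := h.pos x₀
  have hle : ∀ x ∈ Set.Icc (y - r) (y + r), φ x ≤ M * η x := fun x hx =>
    (div_le_iff₀ (h.pos x)).1 (hmax hx)
  have heqM : φ x₀ = M * η x₀ := by rw [hM]; field_simp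
  have hy : m ≤ M * η y := by
    have := hle y (by constructor <;> linarith)
    simpa [hφ] using this
  by_contra! hlt
  have hM1 : 1 < M := by
    by_contra! hM1
    nlinarith [h.pos y]
  have hφpos : 0 < φ x₀ := by rw [heqM]; positivity
  have hne1 : x₀ ≠ y - r := by
    rintro hx
    have : φ x₀ = 0 := by
      simp only [hφ, hx]
      rw [show k * (y - r - y) = -(k * r) by ring, hkr]
      simp
    linarith
  have hne2 : x₀ ≠ y + r := by
    rintro hx
    have : φ x₀ = 0 := by
      simp only [hφ, hx]
      rw [show k * (y + r - y) = k * r by ring, hkr]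
      simp
    linarith
  have hnhds : Set.Icc (y - r) (y + r) ∈ 𝓝 x₀ :=
    Icc_mem_nhds (lt_of_le_of_ne hx₀.1 hne1.symm) (lt_of_le_of_ne hx₀.2 hne2)
  have hloc : IsLocalMax (fun x => φ x - M * η x) x₀ := by
    filter_upwards [hnhds] with x hx
    have := hle x hx
    linarith
  have hd1 : deriv (fun x => φ x - M * η x) =
      fun x => -(m * k) * Real.sin (k * (x - y)) - M * deriv η x := by
    funext x
    have e1 : HasDerivAt φ (m * (-Real.sin (k * (x - y)) * (k * 1))) x :=
      ((((hasDerivAt_id x).sub_const y).const_mul k).cos).const_mul m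
    have e2 : HasDerivAt η (deriv η x) x :=
      (h.contDiff.differentiable (by norm_num) x).hasDerivAt
    refine (e1.sub (e2.const_mul M)).deriv.trans ?_
    ring
  have hd2 : deriv (deriv fun x => φ x - M * η x) x₀ =
      -k ^ 2 * φ x₀ - M * deriv (deriv η) x₀ := by
    rw [hd1]
    have e1 : HasDerivAt (fun x => -(m * k) * Real.sin (k * (x - y)))
        (-(m * k) * (Real.cos (k * (x₀ - y)) * (k * 1))) x₀ :=
      ((((hasDerivAt_id x₀).sub_const y).const_mul k).sin).const_mul _
    have hdiff : Differentiable ℝ (deriv η) :=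
      ((contDiff_succ_iff_deriv (n := 1)).1 h.contDiff).2.2.differentiable (by norm_num)
    refine (e1.sub ((hdiff x₀).hasDerivAt.const_mul M)).deriv.trans ?_
    simp only [hφ]
    ring
  have hnonpos := deriv_deriv_nonpos_of_isLocalMax (g := fun x => φ x - M * η x)
    (hφc.sub (continuous_const.mul hc)).continuousAt hloc
  rw [hd2] at hnonpos
  have heq := h.eqn x₀
  have key : (1 - x₀ ^ 2 - ε ^ 2 * k ^ 2 - η x₀ ^ 2) * φ x₀ ≤ 0 := by
    have e : (1 - x₀ ^ 2 - ε ^ 2 * k ^ 2 - η x₀ ^ 2) * φ x₀ =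
        ε ^ 2 * (-k ^ 2 * φ x₀ - M * deriv (deriv η) x₀) := by
      linear_combination (1 - x₀ ^ 2 - η x₀ ^ 2) * heqM + M * heq
    rw [e]
    exact mul_nonpos_of_nonneg_of_nonpos (sq_nonneg ε) hnonpos
  have key2 : 1 - x₀ ^ 2 - ε ^ 2 * k ^ 2 ≤ η x₀ ^ 2 := by
    by_contra! hlt2
    have : 0 < (1 - x₀ ^ 2 - ε ^ 2 * k ^ 2 - η x₀ ^ 2) * φ x₀ := by
      apply mul_pos _ hφpos
      linarith
    linarith
  have hφm : φ x₀ ≤ m := by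
    have := Real.cos_le_one (k * (x₀ - y))
    simp only [hφ]
    nlinarith
  have hηφ : η x₀ < φ x₀ := by rw [heqM]; nlinarith
  have := hsub x₀ hx₀
  nlinarith

/-- A bump of half-width `√ε` balances the two losses: `(|y| + √ε)² ≤ 2y² + 2ε` from the potential
and `ε²k² = επ²/4 ≤ 3ε` from the curvature. If the resulting `m2` is not positive, the bound is
trivial. -/
theorem one_sub_sq_le (h : IsGroundState ε η) (hε : 0 < ε) (y : ℝ) :
    1 - η y ^ 2 ≤ 2 * y ^ 2 + 5 * ε := by
  set r := √ε with hr
  have hr0 : 0 < r := Real.sqrt_pos.2 hε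
  have hr2 : r ^ 2 = ε := Real.sq_sqrt hε.le
  set m2 := 1 - (|y| + r) ^ 2 - ε * (Real.pi ^ 2 / 4) with hm2
  have hy2 : |y| ^ 2 = y ^ 2 := sq_abs y
  have hpi : Real.pi ^ 2 / 4 ≤ 3 := by nlinarith [Real.pi_lt_d2, Real.pi_pos]
  have hlow : 1 - 2 * y ^ 2 - 5 * ε ≤ m2 := by
    nlinarith [sq_nonneg (|y| - r)]
  rcases le_or_gt m2 0 with hneg | hpos
  · nlinarith [sq_nonneg (η y)]
  · have hk : ε ^ 2 * (Real.pi / (2 * r)) ^ 2 = ε * (Real.pi ^ 2 / 4) := by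
      rw [div_pow, mul_pow, hr2]
      field_simp
      ring
    have := h.le_of_subsolution (m := √m2) (k := Real.pi / (2 * r)) (y := y) (r := r)
      (Real.sqrt_pos.2 hpos) hr0 (by field_simp) (by
        intro x hx
        rw [Real.sq_sqrt hpos.le, hk]
        have hx' : |x| ≤ |y| + r := by
          have : |x - y| ≤ r := abs_le.2 ⟨by linarith [hx.1], by linarith [hx.2]⟩
          have := abs_sub_abs_le_abs_sub x y
          linarith
        have : x ^ 2 ≤ (|y| + r) ^ 2 := by
          rw [← sq_abs x]; gcongr
        linarith)
    have h2 : m2 ≤ η y ^ 2 := by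
      rw [← Real.sq_sqrt hpos.le]; gcongr
    linarith

end IsGroundState

/-! ### Overlap profiles and their primitives -/

open MeasureTheory Real

/-- The product of two squared hyperbolic secants centred at `-τ` and `τ`. -/
noncomputable def sechOverlap (τ z : ℝ) : ℝ := sech (z + τ) ^ 2 * sech (z - τ) ^ 2

/-- The antisymmetrised product of `tanh` and `sech²` centred at `-τ` and `τ`. -/
noncomputable def tanhOverlap (τ z : ℝ) : ℝ :=
  tanh (z + τ) * sech (z - τ) ^ 2 - tanh (z - τ) * sech (z + τ) ^ 2

theorem cosh_add_mul_cosh_sub (z τ : ℝ) :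
    cosh (z + τ) * cosh (z - τ) = (cosh (2 * z) + cosh (2 * τ)) / 2 := by
  rw [cosh_add, cosh_sub, cosh_two_mul, cosh_two_mul]
  linear_combination (cosh τ ^ 2 - 1 / 2) * cosh_sq z + (sinh z ^ 2 + 1 / 2) * cosh_sq τ

theorem sechOverlap_eq (τ z : ℝ) :
    sechOverlap τ z = 4 / (cosh (2 * z) + cosh (2 * τ)) ^ 2 := by
  have h := cosh_add_mul_cosh_sub z τ
  have h1 := (cosh_pos (z + τ)).ne'
  have h2 := (cosh_pos (z - τ)).ne'
  have h3 : cosh (2 * z) + cosh (2 * τ) = 2 * (cosh (z + τ) * cosh (z - τ)) := by linarith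
  rw [h3, sechOverlap, sech, sech]
  field_simp
  norm_num

/-- This form shows the sign and the decay, both hidden by the difference in the definition. -/
theorem tanhOverlap_eq (τ z : ℝ) :
    tanhOverlap τ z = 4 * cosh (2 * z) * sinh (2 * τ) / (cosh (2 * z) + cosh (2 * τ)) ^ 2 := by
  have h := cosh_add_mul_cosh_sub z τ
  have h1 := (cosh_pos (z + τ)).ne'
  have h2 := (cosh_pos (z - τ)).ne'
  have h3 : cosh (2 * z) + cosh (2 * τ) = 2 * (cosh (z + τ) * cosh (z - τ)) := by linarith
  have h4 : cosh (2 * z) * sinh (2 * τ) =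
      sinh (z + τ) * cosh (z + τ) - sinh (z - τ) * cosh (z - τ) := by
    have e1 : 2 * z = (z + τ) + (z - τ) := by ring
    have e2 : 2 * τ = (z + τ) - (z - τ) := by ring
    generalize z + τ = u at *
    generalize z - τ = v at *
    rw [e1, e2, cosh_add, sinh_sub]
    linear_combination (-sinh v * cosh v) * cosh_sq u + (sinh u * cosh u) * cosh_sq v
  rw [h3, mul_assoc 4, h4, tanhOverlap, sech, sech, tanh_eq_sinh_div_cosh, tanh_eq_sinh_div_cosh]
  field_simp
  ring

theorem tendsto_tanh_atTop : Tendsto tanh atTop (𝓝 1) := by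
  have h : tanh = fun x => (1 - exp (-(2 * x))) / (1 + exp (-(2 * x))) := by
    funext x
    rw [tanh_eq, div_eq_div_iff (by positivity) (by positivity),
      show -(2 * x) = -x + -x by ring, exp_add]
    have : exp x * exp (-x) = 1 := by rw [← exp_add]; simp
    linear_combination 2 * exp (-x) * this
  have h0 : Tendsto (fun x : ℝ => exp (-(2 * x))) atTop (𝓝 0) :=
    tendsto_exp_neg_atTop_nhds_zero.comp (tendsto_id.const_mul_atTop (by norm_num : (0 : ℝ) < 2))
  rw [h]
  have h1 := ((tendsto_const_nhds (x := (1 : ℝ))).sub h0).div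
    ((tendsto_const_nhds (x := (1 : ℝ))).add h0) (by norm_num)
  simp only [sub_zero, add_zero, div_one] at h1
  exact h1

theorem tendsto_tanh_atBot : Tendsto tanh atBot (𝓝 (-1)) := by
  have := (tendsto_tanh_atTop.comp tendsto_neg_atBot_atTop).neg
  simpa [Function.comp_def] using this

theorem tendsto_log_cosh_sub_atTop :
    Tendsto (fun x => log (cosh x) - x) atTop (𝓝 (-log 2)) := by
  have h : (fun x => log (cosh x) - x) = fun x => log ((1 + exp (-(2 * x))) / 2) := by
    funext x
    have : (1 + exp (-(2 * x))) / 2 = cosh x / exp x := by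
      rw [cosh_eq, show -(2 * x) = -x - x by ring, exp_sub]
      field_simp
    rw [this, log_div (cosh_pos x).ne' (exp_pos x).ne', log_exp]
  have h0 : Tendsto (fun x : ℝ => exp (-(2 * x))) atTop (𝓝 0) :=
    tendsto_exp_neg_atTop_nhds_zero.comp (tendsto_id.const_mul_atTop (by norm_num : (0 : ℝ) < 2))
  rw [h]
  have := ((tendsto_const_nhds (x := (1 : ℝ))).add h0).div_const 2
  convert this.log (by norm_num) using 2
  rw [← log_inv]; norm_num

theorem tendsto_log_cosh_diff_atTop (τ : ℝ) :
    Tendsto (fun z => log (cosh (z + τ)) - log (cosh (z - τ))) atTop (𝓝 (2 * τ)) := by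
  have h1 := tendsto_log_cosh_sub_atTop.comp (tendsto_atTop_add_const_right atTop τ tendsto_id)
  have h2 := tendsto_log_cosh_sub_atTop.comp (tendsto_atTop_add_const_right atTop (-τ) tendsto_id)
  have h3 := (h1.sub h2).add_const (2 * τ)
  simp only [sub_self, zero_add] at h3
  refine h3.congr fun z => ?_
  simp only [Function.comp_apply, id, ← sub_eq_add_neg]
  ring

theorem tendsto_log_cosh_diff_atBot (τ : ℝ) :
    Tendsto (fun z => log (cosh (z + τ)) - log (cosh (z - τ))) atBot (𝓝 (-(2 * τ))) := by
  refine ((tendsto_log_cosh_diff_atTop τ).comp tendsto_neg_atBot_atTop).neg.congr fun z => ?_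
  simp only [Function.comp_apply]
  rw [← cosh_neg (-z + τ), ← cosh_neg (-z - τ)]
  ring_nf

theorem tendsto_tanh_add_tanh_atTop (τ : ℝ) :
    Tendsto (fun z => tanh (z + τ) + tanh (z - τ)) atTop (𝓝 2) := by
  have h1 := tendsto_tanh_atTop.comp (tendsto_atTop_add_const_right atTop τ tendsto_id)
  have h2 := tendsto_tanh_atTop.comp (tendsto_atTop_add_const_right atTop (-τ) tendsto_id)
  have h3 := h1.add h2
  norm_num at h3
  exact h3

theorem tendsto_tanh_add_tanh_atBot (τ : ℝ) :
    Tendsto (fun z => tanh (z + τ) + tanh (z - τ)) atBot (𝓝 (-2)) := by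
  have h1 := tendsto_tanh_atBot.comp (tendsto_atBot_add_const_right atBot τ tendsto_id)
  have h2 := tendsto_tanh_atBot.comp (tendsto_atBot_add_const_right atBot (-τ) tendsto_id)
  have h3 := h1.add h2
  norm_num at h3
  exact h3

theorem hasDerivAt_tanh (x : ℝ) : HasDerivAt tanh (sech x ^ 2) x := by
  have h := (hasDerivAt_sinh x).div (hasDerivAt_cosh x) (cosh_pos x).ne'
  have e : tanh = sinh / cosh := by
    funext y; exact tanh_eq_sinh_div_cosh y
  rw [e]
  refine h.congr_deriv ?_
  have h1 := (cosh_pos x).ne'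
  rw [sech]
  field_simp
  linear_combination cosh_sq x

theorem hasDerivAt_log_cosh_diff (τ z : ℝ) :
    HasDerivAt (fun z => log (cosh (z + τ)) - log (cosh (z - τ)))
      (tanh (z + τ) - tanh (z - τ)) z := by
  have h1 := (((hasDerivAt_id z).add_const τ).cosh).log (cosh_pos _).ne'
  have h2 := (((hasDerivAt_id z).sub_const τ).cosh).log (cosh_pos _).ne'
  refine (h1.sub h2).congr_deriv ?_
  simp [tanh_eq_sinh_div_cosh]

theorem hasDerivAt_tanh_add_tanh (τ z : ℝ) :
    HasDerivAt (fun z => tanh (z + τ) + tanh (z - τ))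
      (sech (z + τ) ^ 2 + sech (z - τ) ^ 2) z := by
  have h1 := (hasDerivAt_tanh (z + τ)).comp_add_const z τ
  have h2 := (hasDerivAt_tanh (z - τ)).comp_sub_const z τ
  exact h1.add h2

/-- Partial fractions: each term on the right is the derivative of a function with known limits at
`±∞`. -/
theorem sinh_sq_mul_sechOverlap {τ : ℝ} (hτ : 0 < τ) (z : ℝ) :
    sinh (2 * τ) ^ 2 * sechOverlap τ z =
      2 * (cosh (2 * τ) / sinh (2 * τ)) * (tanh (z + τ) - tanh (z - τ))
        - (sech (z + τ) ^ 2 + sech (z - τ) ^ 2) := by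
  have h1 := (cosh_pos (z + τ)).ne'
  have h2 := (cosh_pos (z - τ)).ne'
  have hs : sinh (2 * τ) ≠ 0 := (sinh_pos_iff.2 (by linarith)).ne'
  have hd : tanh (z + τ) - tanh (z - τ) = sinh (2 * τ) / (cosh (z + τ) * cosh (z - τ)) := by
    rw [show 2 * τ = (z + τ) - (z - τ) by ring, sinh_sub, tanh_eq_sinh_div_cosh,
      tanh_eq_sinh_div_cosh]
    field_simp
  rw [hd, sechOverlap, sech, sech]
  have e2 : 2 * τ = (z + τ) - (z - τ) := by ring
  field_simp
  rw [e2]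
  generalize z + τ = u at *
  generalize z - τ = v at *
  rw [sinh_sub, cosh_sub]
  linear_combination (-sinh v ^ 2 - 1) * cosh_sq u + (1 + sinh u ^ 2 - 2 * cosh u ^ 2) * cosh_sq v

theorem tanhOverlap_eq_sub (τ z : ℝ) :
    tanhOverlap τ z = 2 * (tanh (z + τ) - tanh (z - τ))
      - cosh (2 * τ) * sinh (2 * τ) * sechOverlap τ z := by
  have h1 := (cosh_pos (z + τ)).ne'
  have h2 := (cosh_pos (z - τ)).ne'
  rw [tanhOverlap, sechOverlap, sech, sech, tanh_eq_sinh_div_cosh, tanh_eq_sinh_div_cosh,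
    show 2 * τ = (z + τ) - (z - τ) by ring]
  generalize z + τ = u at *
  generalize z - τ = v at *
  rw [sinh_sub, cosh_sub]
  field_simp
  linear_combination (sinh v * cosh v) * cosh_sq u - (sinh u * cosh u) * cosh_sq v

/-! ### Integrability against the hyperbolic secant -/

theorem sech_pos (x : ℝ) : 0 < sech x := one_div_pos.2 (cosh_pos x)

theorem continuous_sech : Continuous sech :=
  continuous_const.div continuous_cosh fun x => (cosh_pos x).ne'

theorem continuous_tanh : Continuous tanh :=
  continuous_iff_continuousAt.2 fun x => (hasDerivAt_tanh x).continuousAt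

/-- The terms of order 2 and 4 of the exponential series, with `1 ≤ e^{|z|}`, give `(1 + z²)² ≤ (1 +
4 + 24) e^{|z|}`; then `e^{|z|} ≤ 2 cosh z`. -/
theorem one_add_sq_mul_sech_le (z : ℝ) : (1 + z ^ 2) * sech z ≤ 58 * (1 + z ^ 2)⁻¹ := by
  have h2 := pow_div_factorial_le_exp |z| (abs_nonneg z) 2
  have h4 := pow_div_factorial_le_exp |z| (abs_nonneg z) 4
  have h0 : 1 ≤ exp |z| := one_le_exp (abs_nonneg z)
  have hc : exp |z| ≤ 2 * cosh z := by
    rw [← cosh_abs, cosh_eq]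
    linarith [exp_pos (-|z|)]
  have e2 : |z| ^ 2 = z ^ 2 := sq_abs z
  have e4 : |z| ^ 4 = z ^ 4 := by rw [show 4 = 2 * 2 by norm_num, pow_mul, pow_mul, e2]
  norm_num [Nat.factorial, e2, e4] at h2 h4
  have hp : 0 < 1 + z ^ 2 := by positivity
  have hcp := cosh_pos z
  rw [sech, mul_one_div, ← div_eq_mul_inv, div_le_div_iff₀ hcp hp]
  nlinarith

theorem integrable_one_add_sq_mul_sech : Integrable fun z : ℝ => (1 + z ^ 2) * sech z := by
  refine (integrable_inv_one_add_sq.const_mul 58).mono'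
    ((by fun_prop : Continuous fun z : ℝ => 1 + z ^ 2).mul
      continuous_sech).aestronglyMeasurable (Eventually.of_forall fun z => ?_)
  rw [norm_of_nonneg (mul_nonneg (by positivity) (sech_pos z).le)]
  exact one_add_sq_mul_sech_le z

theorem integrable_sq_mul_sech : Integrable fun z : ℝ => z ^ 2 * sech z := by
  refine integrable_one_add_sq_mul_sech.mono'
    ((by fun_prop : Continuous fun z : ℝ => z ^ 2).mul
      continuous_sech).aestronglyMeasurable (Eventually.of_forall fun z => ?_)
  have := sech_pos z
  rw [norm_of_nonneg (by positivity)]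
  nlinarith

theorem integrable_sech : Integrable sech := by
  refine integrable_one_add_sq_mul_sech.mono'
    continuous_sech.aestronglyMeasurable (Eventually.of_forall fun z => ?_)
  have := sech_pos z
  rw [norm_of_nonneg this.le]
  nlinarith [mul_nonneg (sq_nonneg z) this.le]

/-! ### Integrals of weights against `η²` -/

section Weight

variable {W : ℝ → ℝ} {c d τ : ℝ}

theorem integrable_of_le_sech (hW : Continuous W) (h0 : ∀ z, 0 ≤ W z)
    (hc : ∀ z, W z ≤ c * sech z) : Integrable W :=
  (integrable_sech.const_mul c).mono' hW.aestronglyMeasurable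
    (Eventually.of_forall fun z => by rw [norm_of_nonneg (h0 z)]; exact hc z)

theorem integrable_sq_mul_of_le_sech (hW : Continuous W) (h0 : ∀ z, 0 ≤ W z)
    (hc : ∀ z, W z ≤ c * sech z) : Integrable fun z => z ^ 2 * W z := by
  refine (integrable_sq_mul_sech.const_mul c).mono'
    ((continuous_pow 2).mul hW).aestronglyMeasurable (Eventually.of_forall fun z => ?_)
  rw [norm_of_nonneg (mul_nonneg (sq_nonneg z) (h0 z))]
  nlinarith [mul_le_mul_of_nonneg_left (hc z) (sq_nonneg z)]

/-- The integral is split at `|z| = 2τ`. The constant `c` serves integrability only; the tail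
constant `d` enters the estimate and has to be no larger in order than the mass of `W`. -/
theorem integral_sq_mul_le (hτ : 0 ≤ τ) (hd0 : 0 ≤ d) (hW : Continuous W) (h0 : ∀ z, 0 ≤ W z)
    (hc : ∀ z, W z ≤ c * sech z) (hd : ∀ z, 2 * τ ≤ |z| → W z ≤ d * sech z) :
    ∫ z, z ^ 2 * W z ≤ 4 * τ ^ 2 * (∫ z, W z) + d * ∫ z, z ^ 2 * sech z := by
  have hi := integrable_of_le_sech hW h0 hc
  rw [← integral_const_mul, ← integral_const_mul,
    ← integral_add (hi.const_mul _) (integrable_sq_mul_sech.const_mul _)]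
  refine integral_mono (integrable_sq_mul_of_le_sech hW h0 hc)
    ((hi.const_mul _).add (integrable_sq_mul_sech.const_mul _)) fun z => ?_
  have hs := sech_pos z
  have hw := h0 z
  rcases le_total (2 * τ) |z| with h | h
  · have h1 := mul_le_mul_of_nonneg_left (hd z h) (sq_nonneg z)
    have h2 : 0 ≤ 4 * τ ^ 2 * W z := by positivity
    simp only
    linarith
  · have h1 : z ^ 2 ≤ 4 * τ ^ 2 := by
      rw [← sq_abs z]; nlinarith [abs_nonneg z]
    have h2 := mul_le_mul_of_nonneg_right h1 hw
    have h3 : 0 ≤ d * (z ^ 2 * sech z) := by positivity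
    simp only
    linarith

/-- Integrating a rescaled weight against the density `η²` loses at most the second moment of the
weight and a term of order `ε`. -/
theorem IsGroundState.integral_sq_mul_bounds {ε κ : ℝ} {η : ℝ → ℝ} (h : IsGroundState ε η)
    (hε : 0 < ε) (hκ : 0 < κ) (hW : Continuous W) (h0 : ∀ z, 0 ≤ W z)
    (hc : ∀ z, W z ≤ c * sech z) :
    (∫ z, W z) - (2 * (κ ^ 2)⁻¹ * (∫ z, z ^ 2 * W z) + 5 * ε * ∫ z, W z) ≤
        κ * ∫ x, η x ^ 2 * W (κ * x) ∧
      κ * (∫ x, η x ^ 2 * W (κ * x)) ≤ ∫ z, W z := by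
  have hi := integrable_of_le_sech hW h0 hc
  have hi2 := integrable_sq_mul_of_le_sech hW h0 hc
  have hηc : Continuous η := h.contDiff.continuous
  have hη1 : ∀ x, η x ^ 2 ≤ 1 := fun x => by nlinarith [h.le_one x, h.pos x]
  have hscale : ∀ g : ℝ → ℝ, ∫ z, g z = κ * ∫ x, g (κ * x) := fun g => by
    rw [Measure.integral_comp_mul_left, abs_of_pos (inv_pos.2 hκ), smul_eq_mul,
      mul_inv_cancel_left₀ hκ.ne']
  have hiκ : Integrable fun x => W (κ * x) := hi.comp_mul_left' hκ.ne'
  have hi2κ : Integrable fun x => (κ * x) ^ 2 * W (κ * x) := hi2.comp_mul_left' hκ.ne'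
  have hiη : Integrable fun x => η x ^ 2 * W (κ * x) := by
    refine hiκ.mono' ((hηc.pow 2).mul (hW.comp (continuous_const.mul
      continuous_id))).aestronglyMeasurable (Eventually.of_forall fun x => ?_)
    rw [norm_of_nonneg (mul_nonneg (sq_nonneg _) (h0 _))]
    exact mul_le_of_le_one_left (h0 _) (hη1 x)
  constructor
  · rw [hscale fun z => z ^ 2 * W z, hscale W]
    have key : (∫ x, W (κ * x)) - (2 * (κ ^ 2)⁻¹ * (∫ x, (κ * x) ^ 2 * W (κ * x))
        + 5 * ε * ∫ x, W (κ * x)) ≤ ∫ x, η x ^ 2 * W (κ * x) := by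
      have hisum : Integrable fun x =>
          2 * (κ ^ 2)⁻¹ * ((κ * x) ^ 2 * W (κ * x)) + 5 * ε * W (κ * x) :=
        (hi2κ.const_mul _).add (hiκ.const_mul _)
      rw [← integral_const_mul, ← integral_const_mul,
        ← integral_add (hi2κ.const_mul _) (hiκ.const_mul _), ← integral_sub hiκ hisum]
      refine integral_mono (hiκ.sub hisum) hiη fun x => ?_
      have h1 := mul_le_mul_of_nonneg_right (h.one_sub_sq_le hε x) (h0 (κ * x))
      have h2 : 2 * (κ ^ 2)⁻¹ * ((κ * x) ^ 2 * W (κ * x)) = 2 * x ^ 2 * W (κ * x) := by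
        field_simp
      simp only [h2]
      linarith
    have := mul_le_mul_of_nonneg_left key hκ.le
    linarith
  · rw [hscale W]
    refine mul_le_mul_of_nonneg_left (integral_mono hiη hiκ fun x => ?_) hκ.le
    exact mul_le_of_le_one_left (h0 _) (hη1 x)

end Weight

/-! ### Size of the overlap profiles -/

theorem continuous_sechOverlap (τ : ℝ) : Continuous (sechOverlap τ) :=
  ((continuous_sech.comp (continuous_add_const τ)).pow 2).mul
    ((continuous_sech.comp (continuous_sub_right τ)).pow 2)

theorem continuous_tanhOverlap (τ : ℝ) : Continuous (tanhOverlap τ) :=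
  ((continuous_tanh.comp (continuous_add_const τ)).mul
    ((continuous_sech.comp (continuous_sub_right τ)).pow 2)).sub
  ((continuous_tanh.comp (continuous_sub_right τ)).mul
    ((continuous_sech.comp (continuous_add_const τ)).pow 2))

theorem sechOverlap_nonneg (τ z : ℝ) : 0 ≤ sechOverlap τ z :=
  mul_nonneg (sq_nonneg _) (sq_nonneg _)

theorem tanhOverlap_nonneg {τ : ℝ} (hτ : 0 < τ) (z : ℝ) : 0 ≤ tanhOverlap τ z := by
  rw [tanhOverlap_eq]
  have := cosh_pos (2 * z)
  have : 0 < sinh (2 * τ) := sinh_pos_iff.2 (by linarith)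
  positivity

theorem cosh_sq_le_cosh_two_mul (z : ℝ) : cosh z ^ 2 ≤ cosh (2 * z) := by
  rw [cosh_two_mul]; nlinarith [sq_nonneg (sinh z)]

theorem sechOverlap_le (τ z : ℝ) : sechOverlap τ z ≤ 4 * sech z ^ 4 := by
  have h1 := cosh_sq_le_cosh_two_mul z
  have h2 := cosh_pos (2 * τ)
  have h3 := cosh_pos z
  rw [sechOverlap_eq, sech, div_pow, one_pow, mul_one_div]
  apply div_le_div_of_nonneg_left (by norm_num) (by positivity)
  calc cosh z ^ 4 = (cosh z ^ 2) ^ 2 := by ring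
    _ ≤ (cosh (2 * z) + cosh (2 * τ)) ^ 2 := by gcongr; linarith

theorem tanhOverlap_le {τ : ℝ} (hτ : 0 < τ) (z : ℝ) :
    tanhOverlap τ z ≤ 4 * sinh (2 * τ) * sech z ^ 2 := by
  have h1 := cosh_sq_le_cosh_two_mul z
  have h2 := cosh_pos (2 * τ)
  have h3 := cosh_pos z
  have h4 : 0 < sinh (2 * τ) := sinh_pos_iff.2 (by linarith)
  have h5 := cosh_pos (2 * z)
  rw [tanhOverlap_eq, sech, div_pow, one_pow, mul_one_div, div_le_div_iff₀ (by positivity)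
    (by positivity)]
  have : cosh (2 * z) * cosh z ^ 2 ≤ (cosh (2 * z) + cosh (2 * τ)) ^ 2 := by
    calc cosh (2 * z) * cosh z ^ 2 ≤ cosh (2 * z) * cosh (2 * z) := by gcongr
      _ ≤ (cosh (2 * z) + cosh (2 * τ)) ^ 2 := by nlinarith
  calc 4 * cosh (2 * z) * sinh (2 * τ) * cosh z ^ 2
      = 4 * sinh (2 * τ) * (cosh (2 * z) * cosh z ^ 2) := by ring
    _ ≤ _ := by gcongr

theorem sech_le_one (z : ℝ) : sech z ≤ 1 := by
  rw [sech, div_le_one (cosh_pos z)]; exact one_le_cosh z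

theorem sechOverlap_le_sech (τ z : ℝ) : sechOverlap τ z ≤ 4 * sech z := by
  have h := sechOverlap_le τ z
  have := pow_le_of_le_one (sech_pos z).le (sech_le_one z) (n := 4) (by norm_num)
  linarith

theorem tanhOverlap_le_sech {τ : ℝ} (hτ : 0 < τ) (z : ℝ) :
    tanhOverlap τ z ≤ 4 * sinh (2 * τ) * sech z := by
  have h := tanhOverlap_le hτ z
  have h4 : 0 < sinh (2 * τ) := sinh_pos_iff.2 (by linarith)
  have := pow_le_of_le_one (sech_pos z).le (sech_le_one z) (n := 2) (by norm_num)
  nlinarith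

theorem sech_le_two_mul_exp (z : ℝ) : sech z ≤ 2 * exp (-|z|) := by
  rw [sech, ← cosh_abs, div_le_iff₀ (cosh_pos _), cosh_eq]
  have : exp (-|z|) * exp |z| = 1 := by rw [← exp_add]; simp
  nlinarith [exp_pos (-|z|)]

/-- Of the four factors in `sech⁴`, two produce the `e^{-4τ}` that the total integral also carries,
and one is kept for integrability. -/
theorem sechOverlap_le_tail {τ z : ℝ} (hz : 2 * τ ≤ |z|) :
    sechOverlap τ z ≤ 16 * exp (-(4 * τ)) * sech z := by
  have h := sechOverlap_le τ z
  have h1 := sech_pos z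
  have h2 := sech_le_one z
  have h3 : sech z ^ 2 ≤ 4 * exp (-(4 * τ)) := by
    calc sech z ^ 2 ≤ (2 * exp (-(2 * τ))) ^ 2 := by
          gcongr
          exact (sech_le_two_mul_exp z).trans (by gcongr)
      _ = 4 * exp (-(4 * τ)) := by
          rw [mul_pow, ← exp_nat_mul]; norm_num; ring_nf
  calc sechOverlap τ z ≤ 4 * (sech z ^ 2 * sech z) * sech z := by linarith
    _ ≤ 4 * (4 * exp (-(4 * τ)) * 1) * sech z := by gcongr
    _ = _ := by ring

/-- One of the two factors `sech z` absorbs the exponentially large `sinh (2τ)`, so the constant is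
uniform in `τ`. -/
theorem tanhOverlap_le_tail {τ z : ℝ} (hτ : 0 < τ) (hz : 2 * τ ≤ |z|) :
    tanhOverlap τ z ≤ 4 * sech z := by
  have h := tanhOverlap_le hτ z
  have h1 := sech_pos z
  have h2 : sinh (2 * τ) * sech z ≤ 1 := by
    rw [sech, mul_one_div, div_le_one (cosh_pos z)]
    calc sinh (2 * τ) ≤ cosh (2 * τ) := (sinh_lt_cosh _).le
      _ ≤ cosh z := by rw [cosh_le_cosh, abs_of_pos (by linarith)]; exact hz
  nlinarith

/-! ### Exact integrals and their behaviour for large separation -/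

theorem integral_sechOverlap {τ : ℝ} (hτ : 0 < τ) :
    sinh (2 * τ) ^ 2 * ∫ z, sechOverlap τ z =
      4 * (2 * τ * (cosh (2 * τ) / sinh (2 * τ)) - 1) := by
  rw [← integral_const_mul]
  set C := 2 * (cosh (2 * τ) / sinh (2 * τ)) with hC
  rw [integral_of_hasDerivAt_of_tendsto (m := C * -(2 * τ) - (-2)) (n := C * (2 * τ) - 2)
    (f := fun z => C * (log (cosh (z + τ)) - log (cosh (z - τ)))
      - (tanh (z + τ) + tanh (z - τ)))]
  · rw [hC]; ring
  · intro z
    rw [sinh_sq_mul_sechOverlap hτ]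
    exact ((hasDerivAt_log_cosh_diff τ z).const_mul C).sub (hasDerivAt_tanh_add_tanh τ z)
  · exact (integrable_of_le_sech (continuous_sechOverlap τ) (sechOverlap_nonneg τ)
      (sechOverlap_le_sech τ)).const_mul _
  · exact ((tendsto_log_cosh_diff_atBot τ).const_mul C).sub (tendsto_tanh_add_tanh_atBot τ)
  · exact ((tendsto_log_cosh_diff_atTop τ).const_mul C).sub (tendsto_tanh_add_tanh_atTop τ)

theorem integral_tanhOverlap {τ : ℝ} (hτ : 0 < τ) :
    ∫ z, tanhOverlap τ z = 8 * τ - cosh (2 * τ) * sinh (2 * τ) * ∫ z, sechOverlap τ z := by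
  have hi := integrable_of_le_sech (continuous_sechOverlap τ) (sechOverlap_nonneg τ)
    (sechOverlap_le_sech τ)
  have hi' := integrable_of_le_sech (continuous_tanhOverlap τ) (tanhOverlap_nonneg hτ)
    (tanhOverlap_le_sech hτ)
  rw [eq_sub_iff_add_eq, ← integral_const_mul, ← integral_add hi' (hi.const_mul _),
    integral_of_hasDerivAt_of_tendsto (m := 2 * -(2 * τ)) (n := 2 * (2 * τ))
      (f := fun z => 2 * (log (cosh (z + τ)) - log (cosh (z - τ))))]
  · ring
  · intro z
    rw [tanhOverlap_eq_sub, sub_add_cancel]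
    exact (hasDerivAt_log_cosh_diff τ z).const_mul 2
  · exact hi'.add (hi.const_mul _)
  · exact (tendsto_log_cosh_diff_atBot τ).const_mul 2
  · exact (tendsto_log_cosh_diff_atTop τ).const_mul 2

theorem integral_sechOverlap_eq_exp {τ : ℝ} (hτ : 0 < τ) :
    ∫ z, sechOverlap τ z = 16 * exp (-(4 * τ)) *
      (2 * τ - 1 + exp (-(4 * τ)) * (2 * τ + 1)) / (1 - exp (-(4 * τ))) ^ 3 := by
  have h := integral_sechOverlap hτ
  have hq : exp (-(4 * τ)) < 1 := exp_lt_one_iff.2 (by linarith)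
  have hsq : sinh (2 * τ) = exp (2 * τ) * (1 - exp (-(4 * τ))) / 2 := by
    rw [sinh_eq, mul_sub, ← exp_add]; ring_nf
  have hcq : cosh (2 * τ) = exp (2 * τ) * (1 + exp (-(4 * τ))) / 2 := by
    rw [cosh_eq, mul_add, ← exp_add]; ring_nf
  have he : exp (2 * τ) ^ 2 * exp (-(4 * τ)) = 1 := by
    rw [← exp_nat_mul, ← exp_add]; norm_num; ring
  have hp := exp_pos (2 * τ)
  rw [hsq, hcq] at h
  generalize exp (2 * τ) = E at *
  generalize exp (-(4 * τ)) = q at *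
  have h1 : 1 - q ≠ 0 := by linarith
  rw [eq_div_iff (pow_ne_zero 3 h1)]
  field_simp at h
  generalize ∫ z, sechOverlap τ z = J at *
  linear_combination q * h - J * (1 - q) ^ 3 * he

theorem integral_tanhOverlap_eq_exp {τ : ℝ} (hτ : 0 < τ) :
    ∫ z, tanhOverlap τ z = 4 * (1 + exp (-(4 * τ))) / (1 - exp (-(4 * τ)))
      - 32 * τ * exp (-(4 * τ)) / (1 - exp (-(4 * τ))) ^ 2 := by
  rw [integral_tanhOverlap hτ, integral_sechOverlap_eq_exp hτ]
  have hq : exp (-(4 * τ)) < 1 := exp_lt_one_iff.2 (by linarith)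
  have hsq : sinh (2 * τ) = exp (2 * τ) * (1 - exp (-(4 * τ))) / 2 := by
    rw [sinh_eq, mul_sub, ← exp_add]; ring_nf
  have hcq : cosh (2 * τ) = exp (2 * τ) * (1 + exp (-(4 * τ))) / 2 := by
    rw [cosh_eq, mul_add, ← exp_add]; ring_nf
  have he : exp (2 * τ) ^ 2 * exp (-(4 * τ)) = 1 := by
    rw [← exp_nat_mul, ← exp_add]; norm_num; ring
  rw [hsq, hcq]
  generalize exp (2 * τ) = E at *
  generalize exp (-(4 * τ)) = q at *
  have h1 : 1 - q ≠ 0 := by linarith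
  field_simp
  linear_combination (-16 * (1 + q) * (2 * τ - 1 + q * (2 * τ + 1))) * he

theorem exp_neg_four_mul (τ : ℝ) : exp (-(4 * τ)) = exp (-(2 * τ)) ^ 2 := by
  rw [← exp_nat_mul]; norm_num; ring_nf

theorem exp_neg_two_mul_le {τ : ℝ} (hτ : 1 ≤ τ) : exp (-(2 * τ)) ≤ 1 / 7 := by
  have h1 : exp (-(2 * τ)) ≤ exp (-2) := exp_le_exp.2 (by linarith)
  have h2 : exp (-2) = (exp 1 ^ 2)⁻¹ := by rw [← exp_nat_mul, ← exp_neg]; norm_num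
  have h3 : (7 : ℝ) ≤ exp 1 ^ 2 := by nlinarith [exp_one_gt_d9]
  have h4 : (exp 1 ^ 2)⁻¹ ≤ (7 : ℝ)⁻¹ := inv_anti₀ (by norm_num) h3
  linarith

/-- The error is relative because the main term is itself exponentially small; `τ ≥ 1` gives `2τ + 1
≤ 3 (2τ - 1)`, which lets the correction be compared with it. -/
theorem integral_sechOverlap_bounds {τ : ℝ} (hτ : 1 ≤ τ) :
    16 * exp (-(4 * τ)) * (2 * τ - 1) ≤ ∫ z, sechOverlap τ z ∧
      ∫ z, sechOverlap τ z ≤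
        16 * exp (-(4 * τ)) * (2 * τ - 1) * (1 + 2 * exp (-(2 * τ))) := by
  rw [integral_sechOverlap_eq_exp (by linarith), exp_neg_four_mul]
  have hE := exp_neg_two_mul_le hτ
  have hE0 := exp_pos (-(2 * τ))
  generalize exp (-(2 * τ)) = E at *
  have hE2 : E ^ 2 ≤ E / 7 := by nlinarith
  have hE20 : 0 < E ^ 2 := by positivity
  generalize E ^ 2 = q at *
  have hq : q ≤ 1 / 49 := by linarith
  have hd : 0 < (1 - q) ^ 3 := pow_pos (by linarith) 3
  have hd1 : (1 - q) ^ 3 ≤ 1 := pow_le_one₀ (by linarith) (by linarith)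
  have hd3 : 1 - 3 * q ≤ (1 - q) ^ 3 := by nlinarith [sq_nonneg q]
  have hn : 0 < 2 * τ - 1 := by linarith
  constructor
  · rw [le_div_iff₀ hd]
    have h1 : 16 * q * (2 * τ - 1) * (1 - q) ^ 3 ≤ 16 * q * (2 * τ - 1) * 1 := by gcongr
    have h2 : 0 ≤ 16 * q * (q * (2 * τ + 1)) := by positivity
    linarith
  · rw [div_le_iff₀ hd]
    have h1 : 2 * τ - 1 + q * (2 * τ + 1) ≤ (2 * τ - 1) * (1 + 3 * q) := by nlinarith
    have h2 : 1 + 3 * q ≤ (1 + 2 * E) * (1 - 3 * q) := by nlinarith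
    calc 16 * q * (2 * τ - 1 + q * (2 * τ + 1))
        ≤ 16 * q * ((2 * τ - 1) * (1 + 3 * q)) := by gcongr
      _ ≤ 16 * q * ((2 * τ - 1) * ((1 + 2 * E) * (1 - 3 * q))) := by gcongr
      _ ≤ 16 * q * ((2 * τ - 1) * ((1 + 2 * E) * (1 - q) ^ 3)) := by gcongr
      _ = _ := by ring

theorem abs_integral_tanhOverlap_sub_four_le {τ : ℝ} (hτ : 1 ≤ τ) :
    |(∫ z, tanhOverlap τ z) - 4| ≤ 20 * exp (-(2 * τ)) := by
  rw [integral_tanhOverlap_eq_exp (by linarith), exp_neg_four_mul]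
  have hE := exp_neg_two_mul_le hτ
  have hE0 := exp_pos (-(2 * τ))
  -- Half of the exponent in `τ e^{-4τ}` is spent on the factor `τ`, hence the rate `e^{-2τ}`.
  have hτE : 2 * τ * exp (-(2 * τ)) ≤ 1 := by
    have h1 : 2 * τ ≤ exp (2 * τ) := by linarith [add_one_le_exp (2 * τ)]
    calc 2 * τ * exp (-(2 * τ)) ≤ exp (2 * τ) * exp (-(2 * τ)) := by gcongr
      _ = 1 := by rw [← exp_add]; simp
  generalize exp (-(2 * τ)) = E at *
  have hd : 48 / 49 ≤ 1 - E ^ 2 := by nlinarith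
  have hd0 : 0 < 1 - E ^ 2 := by linarith
  have e : 4 * (1 + E ^ 2) / (1 - E ^ 2) - 32 * τ * E ^ 2 / (1 - E ^ 2) ^ 2 - 4 =
      8 * E ^ 2 / (1 - E ^ 2) - 16 * (2 * τ * E) * E / (1 - E ^ 2) ^ 2 := by
    field_simp
    ring
  have h1 : 8 * E ^ 2 / (1 - E ^ 2) ≤ 20 * E := by
    rw [div_le_iff₀ hd0]; nlinarith
  have h2 : 16 * (2 * τ * E) * E / (1 - E ^ 2) ^ 2 ≤ 20 * E := by
    rw [div_le_iff₀ (by positivity)]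
    have : (9 : ℝ) / 10 ≤ (1 - E ^ 2) ^ 2 := by nlinarith
    nlinarith
  have h3 : 0 ≤ 8 * E ^ 2 / (1 - E ^ 2) := by positivity
  have h4 : 0 ≤ 16 * (2 * τ * E) * E / (1 - E ^ 2) ^ 2 := by positivity
  rw [e, abs_le]
  constructor <;> linarith

/-- The second moment of the hyperbolic secant. -/
noncomputable def sechMoment : ℝ := ∫ z, z ^ 2 * sech z

theorem sechMoment_nonneg : 0 ≤ sechMoment :=
  integral_nonneg fun z => mul_nonneg (sq_nonneg z) (sech_pos z).le

/-! ### Overlap integrals against `η²` -/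

namespace IsGroundState

variable {ε κ τ : ℝ} {η : ℝ → ℝ}

theorem abs_integral_tanhOverlap_sub_le (h : IsGroundState ε η) (hε : 0 < ε) (hκ : 0 < κ)
    (hτ : 1 ≤ τ) :
    |κ * (∫ x, η x ^ 2 * tanhOverlap τ (κ * x)) - 4| ≤
      4 * (5 * exp (-(2 * τ)) + 4 * (4 + 4 * sechMoment) * (τ / κ) ^ 2 + 10 * ε) := by
  have hτ0 : 0 < τ := by linarith
  have hS := sechMoment_nonneg
  obtain ⟨h1, h2⟩ := h.integral_sq_mul_bounds hε hκ (continuous_tanhOverlap τ)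
    (tanhOverlap_nonneg hτ0) (tanhOverlap_le_sech hτ0)
  have hm := integral_sq_mul_le hτ0.le (by norm_num : (0 : ℝ) ≤ 4) (continuous_tanhOverlap τ)
    (tanhOverlap_nonneg hτ0) (tanhOverlap_le_sech hτ0) fun z => tanhOverlap_le_tail hτ0
  rw [← sechMoment] at hm
  have hJ := abs_le.1 (abs_integral_tanhOverlap_sub_four_le hτ)
  have hE := exp_neg_two_mul_le hτ
  have hE0 := exp_pos (-(2 * τ))
  generalize (∫ z, tanhOverlap τ z) = J at *
  generalize (∫ z, z ^ 2 * tanhOverlap τ z) = m at *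
  generalize κ * (∫ x, η x ^ 2 * tanhOverlap τ (κ * x)) = P at *
  have hJ1 : 1 ≤ J := by linarith
  have hJ8 : J ≤ 8 := by linarith
  have hm2 : m ≤ (4 + 4 * sechMoment) * τ ^ 2 * 8 := by
    have a1 : 4 * sechMoment ≤ 4 * sechMoment * τ ^ 2 * 8 := by
      rw [mul_assoc (4 * sechMoment)]
      exact le_mul_of_one_le_right (by positivity) (by nlinarith)
    have a2 : 4 * τ ^ 2 * J ≤ 4 * τ ^ 2 * 8 := by gcongr
    linarith
  have hk : 0 < (κ ^ 2)⁻¹ := by positivity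
  have hm3 : 2 * (κ ^ 2)⁻¹ * m ≤ 2 * (κ ^ 2)⁻¹ * ((4 + 4 * sechMoment) * τ ^ 2 * 8) := by gcongr
  have e : 2 * (κ ^ 2)⁻¹ * ((4 + 4 * sechMoment) * τ ^ 2 * 8) =
      16 * (4 + 4 * sechMoment) * (τ / κ) ^ 2 := by
    rw [div_pow]; ring
  have h0 : 0 ≤ (4 + 4 * sechMoment) * (τ / κ) ^ 2 := by positivity
  rw [abs_le]
  constructor <;> nlinarith

theorem abs_integral_sechOverlap_sub_le (h : IsGroundState ε η) (hε : 0 < ε) (hκ : 0 < κ)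
    (hτ : 1 ≤ τ) :
    |κ * (∫ x, η x ^ 2 * sechOverlap τ (κ * x)) - 16 * exp (-(4 * τ)) * (2 * τ - 1)| ≤
      16 * exp (-(4 * τ)) * (2 * τ - 1) *
        (5 * exp (-(2 * τ)) + 4 * (4 + 4 * sechMoment) * (τ / κ) ^ 2 + 10 * ε) := by
  have hτ0 : 0 < τ := by linarith
  have hS := sechMoment_nonneg
  obtain ⟨h1, h2⟩ := h.integral_sq_mul_bounds hε hκ (continuous_sechOverlap τ)
    (sechOverlap_nonneg τ) (sechOverlap_le_sech τ)
  have hm := integral_sq_mul_le hτ0.le (by positivity : 0 ≤ 16 * exp (-(4 * τ)))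
    (continuous_sechOverlap τ) (sechOverlap_nonneg τ) (sechOverlap_le_sech τ)
    fun z => sechOverlap_le_tail
  rw [← sechMoment] at hm
  obtain ⟨hJ1, hJ2⟩ := integral_sechOverlap_bounds hτ
  have hE := exp_neg_two_mul_le hτ
  have hE0 := exp_pos (-(2 * τ))
  have hq := exp_pos (-(4 * τ))
  -- Since `2τ - 1 ≥ 1`, the tail constant is at most the main term, so the second-moment error
  -- stays relative.
  have hN : 16 * exp (-(4 * τ)) ≤ 16 * exp (-(4 * τ)) * (2 * τ - 1) :=
    le_mul_of_one_le_right (by positivity) (by linarith)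
  generalize 16 * exp (-(4 * τ)) * (2 * τ - 1) = N at *
  generalize exp (-(2 * τ)) = E at *
  generalize exp (-(4 * τ)) = q at *
  generalize (∫ z, sechOverlap τ z) = J at *
  generalize (∫ z, z ^ 2 * sechOverlap τ z) = m at *
  generalize κ * (∫ x, η x ^ 2 * sechOverlap τ (κ * x)) = P at *
  have hN0 : 0 < N := by linarith
  have hJN : J ≤ 2 * N := by nlinarith
  have hm2 : m ≤ (4 + 4 * sechMoment) * τ ^ 2 * (2 * N) := by
    have a1 : 16 * q * sechMoment ≤ N * sechMoment := by gcongr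
    have a3 : N * sechMoment ≤ N * sechMoment * τ ^ 2 :=
      le_mul_of_one_le_right (by positivity) (by nlinarith)
    have a2 : 4 * τ ^ 2 * J ≤ 4 * τ ^ 2 * (2 * N) := by gcongr
    have a4 : 0 ≤ N * sechMoment * τ ^ 2 := by positivity
    linarith
  have hk : 0 < (κ ^ 2)⁻¹ := by positivity
  have hm3 : 2 * (κ ^ 2)⁻¹ * m ≤ 2 * (κ ^ 2)⁻¹ * ((4 + 4 * sechMoment) * τ ^ 2 * (2 * N)) := by
    gcongr
  have e : 2 * (κ ^ 2)⁻¹ * ((4 + 4 * sechMoment) * τ ^ 2 * (2 * N)) =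
      N * (4 * (4 + 4 * sechMoment) * (τ / κ) ^ 2) := by
    rw [div_pow]; ring
  have h0 : 0 ≤ N * (4 * (4 + 4 * sechMoment) * (τ / κ) ^ 2) := by positivity
  have h5 : 5 * ε * J ≤ 5 * ε * (2 * N) := by gcongr
  have h6 : 0 < N * E := by positivity
  have h7 : 0 < N * ε := by positivity
  rw [abs_le]
  constructor <;> linarith

end IsGroundState

/-! ### From the integrals to the asymptotic formula -/

/-- Used with `α = a²`: putting the factor `1 - a²` into the main term adds `a²` to the relative
error, up to a factor 2. -/
theorem abs_div_mul_one_sub_sub_one_le {P N β α : ℝ} (hN : 0 < N) (hα0 : 0 ≤ α) (hα : α ≤ 1 / 2)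
    (h : |P - N| ≤ N * β) : |P / (N * (1 - α)) - 1| ≤ 2 * (β + α) := by
  have h1 : 0 < 1 - α := by linarith
  have h2 : P / (N * (1 - α)) - 1 = (P - N * (1 - α)) / (N * (1 - α)) := by field_simp
  have h3 : |P - N * (1 - α)| ≤ N * (β + α) := by
    calc |P - N * (1 - α)| = |(P - N) + N * α| := by ring_nf
      _ ≤ |P - N| + |N * α| := abs_add_le _ _
      _ ≤ N * β + N * α := by rw [abs_of_nonneg (by positivity : 0 ≤ N * α)]; gcongr
      _ = _ := by ring
  have h4 : 0 ≤ N * (β + α) := (abs_nonneg _).trans h3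
  rw [h2, abs_div, abs_of_pos (by positivity : 0 < N * (1 - α)), div_le_iff₀ (by positivity)]
  nlinarith

theorem kineticOverlap_eq (ε : ℝ) (η a b : ℝ → ℝ) (t : ℝ) :
    kineticOverlap ε η a b t =
      1 / 2 * deriv b t * (1 - b t ^ 2) ^ (1 / 2 : ℝ) *
          (∫ x, η x ^ 2 * tanhOverlap (ε⁻¹ * width a b t * a t) (ε⁻¹ * width a b t * x))
        - ε⁻¹ * b t * (1 - b t ^ 2) ^ (3 / 2 : ℝ) *
          (width a b t * deriv a t + deriv (width a b) t * a t) *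
          ∫ x, η x ^ 2 * sechOverlap (ε⁻¹ * width a b t * a t) (ε⁻¹ * width a b t * x) := by
  simp only [kineticOverlap, tanhOverlap, sechOverlap, zPlus, zMinus, mul_add, mul_sub]

theorem width_pos {a b : ℝ → ℝ} {t : ℝ} (ha0 : 0 < a t) (ha1 : a t < 1) (hb0 : -1 < b t)
    (hb1 : b t < 1) : 0 < width a b t := by
  have h1 : 0 < 1 - a t ^ 2 := by nlinarith
  have h2 : 0 < 1 - b t ^ 2 := by nlinarith
  rw [width]
  positivity

/-- In the regime of small overlap, the separation of the solitons in units of their width is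
large, and the overlap is small compared with `ε ^ (1 / 3)`. -/
theorem one_le_and_exp_le_of_overlap_le {C ε τ : ℝ} (hC : 0 < C) (hε : 0 < ε) (hε1 : ε ≤ 1)
    (hεC : C * ε ≤ exp (-4)) (h : exp (-(4 * τ)) ≤ C * ε ^ 2 * |log ε|) :
    1 ≤ τ ∧ exp (-(2 * τ)) ≤ √C * ε ^ (1 / 3 : ℝ) := by
  -- One power of `ε` pays for the logarithm; the remaining one gives `e^{-2τ} ≤ √C ε^{1/2}`, more
  -- than is needed.
  have hlog : ε * |log ε| ≤ 1 := by
    have := abs_log_mul_self_lt ε hε hε1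
    rw [abs_mul, abs_of_pos hε] at this
    linarith
  have hq : exp (-(4 * τ)) ≤ C * ε := by
    calc exp (-(4 * τ)) ≤ C * ε * (ε * |log ε|) := by linarith
      _ ≤ C * ε * 1 := by gcongr
      _ = C * ε := mul_one _
  refine ⟨by linarith [exp_le_exp.1 (hq.trans hεC)], ?_⟩
  set e := ε ^ (1 / 3 : ℝ) with he
  have he0 : 0 < e := rpow_pos_of_pos hε _
  have he1 : e ≤ 1 := rpow_le_one hε.le hε1 (by norm_num)
  have he3 : e ^ 3 = ε := by
    rw [he, ← rpow_natCast, ← rpow_mul hε.le]; norm_num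
  refine (pow_le_pow_iff_left₀ (exp_pos _).le (by positivity) two_ne_zero).1 ?_
  rw [← exp_neg_four_mul, mul_pow, sq_sqrt hC.le]
  calc exp (-(4 * τ)) ≤ C * ε := hq
    _ ≤ C * e ^ 2 := by
      gcongr
      rw [← he3]
      exact pow_le_pow_of_le_one he0.le he1 (by norm_num)

end DarkSoliton

open DarkSoliton in
theorem lemma4 (C₁ C₂ : ℝ) (hC₁ : 0 < C₁) (hC₂ : 0 < C₂) :
    ∃ C ε₀ : ℝ, 0 < C ∧ 0 < ε₀ ∧ ∀ ε : ℝ, 0 < ε → ε < ε₀ →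
      ∀ η : ℝ → ℝ, DarkSoliton.IsGroundState ε η →
        ∃ r₁ r₂ : ℝ → ℝ → ℝ, ∀ (a b : ℝ → ℝ) (t : ℝ),
          DifferentiableAt ℝ a t → DifferentiableAt ℝ b t →
          0 < a t → a t < 1 → -1 < b t → b t < 1 →
          a t ≤ C₁ * ε ^ (1 / 6 : ℝ) →
          Real.exp (-4 * DarkSoliton.width a b t * a t * ε⁻¹) ≤ C₂ * ε ^ 2 * |Real.log ε| →
            |r₁ (a t) (b t)| ≤ C * ε ^ (1 / 3 : ℝ) ∧
            |r₂ (a t) (b t)| ≤ C * ε ^ (1 / 3 : ℝ) ∧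
            DarkSoliton.kineticOverlap ε η a b t =
              2 * ε * deriv b t * (1 - b t ^ 2) ^ (1 / 2 : ℝ) * (DarkSoliton.width a b t)⁻¹ *
                  (1 - a t ^ 2) * (1 + r₁ (a t) (b t))
                - 16 * b t * (1 - b t ^ 2) ^ (3 / 2 : ℝ) *
                  (deriv a t
                    + (DarkSoliton.width a b t)⁻¹ * deriv (DarkSoliton.width a b) t * a t) *
                  (1 - a t ^ 2) * Real.exp (-4 * DarkSoliton.width a b t * a t * ε⁻¹) *
                  (2 * DarkSoliton.width a b t * a t * ε⁻¹ - 1) * (1 + r₂ (a t) (b t)) := by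
  have hS := sechMoment_nonneg
  refine ⟨2 * (5 * √C₂ + 4 * (4 + 4 * sechMoment) * C₁ ^ 2 + 10 + C₁ ^ 2),
    -- The second threshold yields `C₂ ε ≤ e^{-4}`, hence `τ ≥ 1`; the third yields `C₁² ε^{1/3} ≤
    -- 1/2`, hence `a² ≤ 1/2`.
    min (min 1 (Real.exp (-4) / C₂)) ((1 / (2 * C₁ ^ 2)) ^ 3), by positivity, by positivity, ?_⟩
  intro ε hε hlt η hη
  obtain ⟨⟨hε1, hεC₂⟩, hεC₁⟩ : (ε < 1 ∧ ε < Real.exp (-4) / C₂) ∧ ε < (1 / (2 * C₁ ^ 2)) ^ 3 := by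
    simpa only [lt_min_iff] using hlt
  -- The remainders are the exact ratios of integral to main term, minus one. They depend on the
  -- values of `a` and `b` only, and the formula becomes an algebraic identity; only their size
  -- needs analysis.
  let κ : ℝ → ℝ → ℝ := fun α β => ε⁻¹ * (√(1 - α ^ 2) * √(1 - β ^ 2) / √2)
  refine ⟨fun α β => κ α β * (∫ x, η x ^ 2 * tanhOverlap (κ α β * α) (κ α β * x)) /
      (4 * (1 - α ^ 2)) - 1,
    fun α β => κ α β * (∫ x, η x ^ 2 * sechOverlap (κ α β * α) (κ α β * x)) /
      (16 * Real.exp (-(4 * (κ α β * α))) * (2 * (κ α β * α) - 1) * (1 - α ^ 2)) - 1, ?_⟩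
  intro a b t _ _ ha0 ha1 hb0 hb1 ha hov
  have hB := width_pos ha0 ha1 hb0 hb1
  have hκB : κ (a t) (b t) = ε⁻¹ * width a b t := rfl
  simp only [hκB, kineticOverlap_eq]
  set k := ε⁻¹ * width a b t with hk
  have hk0 : 0 < k := by positivity
  have hexp : -4 * width a b t * a t * ε⁻¹ = -(4 * (k * a t)) := by rw [hk]; ring
  have hlin : 2 * width a b t * a t * ε⁻¹ = 2 * (k * a t) := by rw [hk]; ring
  rw [hexp] at hov
  rw [hexp, hlin]
  obtain ⟨hτ, hE⟩ := one_le_and_exp_le_of_overlap_le hC₂ hε hε1.le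
    (by rw [lt_div_iff₀ hC₂] at hεC₂; linarith) hov
  have hdiv : k * a t / k = a t := by field_simp
  have hT := hη.abs_integral_tanhOverlap_sub_le hε hk0 hτ
  have hQ := hη.abs_integral_sechOverlap_sub_le hε hk0 hτ
  rw [hdiv] at hT hQ
  have hsixth : (ε ^ (1 / 6 : ℝ)) ^ 2 = ε ^ (1 / 3 : ℝ) := by
    rw [← Real.rpow_natCast, ← Real.rpow_mul hε.le]; norm_num
  have hcube : (ε ^ (1 / 3 : ℝ)) ^ 3 = ε := by
    rw [← Real.rpow_natCast, ← Real.rpow_mul hε.le]; norm_num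
  have he0 : 0 < ε ^ (1 / 3 : ℝ) := Real.rpow_pos_of_pos hε _
  have he1 : ε ^ (1 / 3 : ℝ) ≤ 1 := Real.rpow_le_one hε.le hε1.le (by norm_num)
  have ha2 : a t ^ 2 ≤ C₁ ^ 2 * ε ^ (1 / 3 : ℝ) := by
    rw [← hsixth, ← mul_pow]; gcongr
  generalize ε ^ (1 / 3 : ℝ) = e at *
  have hεe : ε ≤ e := by
    rw [← hcube]; exact pow_le_of_le_one he0.le he1 (by norm_num)
  have hasmall : a t ^ 2 ≤ 1 / 2 := by
    have h1 : e < 1 / (2 * C₁ ^ 2) := by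
      rw [← hcube] at hεC₁
      exact lt_of_pow_lt_pow_left₀ 3 (by positivity) hεC₁
    rw [lt_div_iff₀ (by positivity)] at h1
    linarith
  have hN : 0 < 16 * Real.exp (-(4 * (k * a t))) * (2 * (k * a t) - 1) :=
    mul_pos (by positivity) (by linarith)
  have hbound : 2 * (5 * Real.exp (-(2 * (k * a t))) + 4 * (4 + 4 * sechMoment) * a t ^ 2 + 10 * ε
      + a t ^ 2) ≤ 2 * (5 * √C₂ + 4 * (4 + 4 * sechMoment) * C₁ ^ 2 + 10 + C₁ ^ 2) * e := by
    have h1 : 4 * (4 + 4 * sechMoment) * a t ^ 2 ≤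
        4 * (4 + 4 * sechMoment) * (C₁ ^ 2 * e) := by gcongr
    linarith
  have ha21 : 0 < 1 - a t ^ 2 := by linarith
  refine ⟨(abs_div_mul_one_sub_sub_one_le (by norm_num) (sq_nonneg _) hasmall hT).trans hbound,
    (abs_div_mul_one_sub_sub_one_le hN (sq_nonneg _) hasmall hQ).trans hbound, ?_⟩
  generalize (∫ x, η x ^ 2 * tanhOverlap (k * a t) (k * x)) = I
  generalize (∫ x, η x ^ 2 * sechOverlap (k * a t) (k * x)) = J
  rw [add_sub_cancel, add_sub_cancel]
  have e1 : 2 * ε * deriv b t * (1 - b t ^ 2) ^ (1 / 2 : ℝ) * (width a b t)⁻¹ * (1 - a t ^ 2) *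
      (k * I / (4 * (1 - a t ^ 2))) = 1 / 2 * deriv b t * (1 - b t ^ 2) ^ (1 / 2 : ℝ) * I := by
    rw [hk]
    field_simp
    norm_num
    ring
  have e2 : 16 * b t * (1 - b t ^ 2) ^ (3 / 2 : ℝ) *
        (deriv a t + (width a b t)⁻¹ * deriv (width a b) t * a t) * (1 - a t ^ 2) *
        Real.exp (-(4 * (k * a t))) * (2 * (k * a t) - 1) *
        (k * J / (16 * Real.exp (-(4 * (k * a t))) * (2 * (k * a t) - 1) * (1 - a t ^ 2))) =
      ε⁻¹ * b t * (1 - b t ^ 2) ^ (3 / 2 : ℝ) *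
        (width a b t * deriv a t + deriv (width a b) t * a t) * J := by
    have hw : deriv a t + (width a b t)⁻¹ * deriv (width a b) t * a t =
        (width a b t)⁻¹ * (width a b t * deriv a t + deriv (width a b) t * a t) := by
      field_simp
    have hq : (1 - a t ^ 2) * Real.exp (-(4 * (k * a t))) * (2 * (k * a t) - 1) *
        (k * J / (16 * Real.exp (-(4 * (k * a t))) * (2 * (k * a t) - 1) * (1 - a t ^ 2))) =
        k * J / 16 := by
      have h0 : 2 * (k * a t) - 1 ≠ 0 := by linarith
      have h1 := Real.exp_pos (-(4 * (k * a t)))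
      generalize Real.exp (-(4 * (k * a t))) = q at *
      generalize 2 * (k * a t) - 1 = p at *
      field_simp
    have hkw : k * (width a b t)⁻¹ = ε⁻¹ := by rw [hk]; field_simp
    rw [hw, ← hkw]
    linear_combination (16 * b t * (1 - b t ^ 2) ^ (3 / 2 : ℝ) *
      ((width a b t)⁻¹ * (width a b t * deriv a t + deriv (width a b) t * a t))) * hq
  rw [e1, e2]
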